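/- Lemma. Let $C>0$ and let $F$ be a real Banach space (for instance $\mathbb R$ or $\mathbb R^3$). For functions of $(x,t)\in\mathbb R^3\times\mathbb R$ let $\square=\Delta-\frac1{C^2}\frac{\partial^2}{\partial t^2}$, and let $K(z,\tau)=\frac{1}{|z|}\,\delta\!\left(\tau-\frac{|z|}{C}\right)$ be the Lorenz kernel, i.e. the measure on $\mathbb R^3\times\mathbb R$ with $\int\varphi\,dK=\int_{\mathbb R^3}\varphi(z,|z|/C)\,\frac{d^3z}{|z|}$. It acts on $F$-valued functions by $$(K*f)(x,t)=\iint K(x-y,t-r)f(y,r)\,d^3y\,dr=\int_{\mathbb R^3}\frac{f(y,t-|x-y|/C)}{|x-y|}\,d^3y .$$ Decay conditions below are required, for each $a\in\mathbb R$, as $|x|\to\infty$ uniformly on the solid past light cone $\{t\le a-|x|/C\}$. Then $K$ and $\square$ are mutually inverse up to the factor $-4\pi$: 1. $\square K=-4\pi\delta_0$ in the sense of distributions: for every $\varphi\in C_c^\infty(\mathbb R^3\times\mathbb R)$ the function $\square\varphi$ is $K$-integrable and $\int\square\varphi\,dK=-4\pi\varphi(0)$. 2. If $f$ is locally integrable and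 $K*\|f\|$ is locally integrable, then the integral defining $K*f$ converges absolutely almost everywhere, $K*f$ is locally integrable, and $\square(K*f)=-4\pi f$ in the sense of distributions. 3. If $f$ is $C^2$ and, for some $p>2$, $f$ and its derivatives of order at most $2$ are $O(|x|^{-p})$, then the integral defining $K*f$ converges absolutely everywhere, $K*f$ is $C^2$, $\square(K*f)=-4\pi f$ pointwise, and $A=K*f$ satisfies $K*(\square A)=-4\pi A$ pointwise. 4. If $A$ is $C^2$, $A\to0$ and the first derivatives of $A$ are $o(|x|^{-1})$, then $(K*\square A)(x,t)=-4\pi A(x,t)$ at every $(x,t)$ at which the integral defining $K*\square A$ converges absolutely. -/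

import Mathlib

open MeasureTheory Filter Topology
open scoped ContDiff

namespace LorenzWave

/-- Euclidean three-space. -/
abbrev Space : Type := EuclideanSpace ℝ (Fin 3)

/-- Events `(x, t)`, with Lebesgue measure `d³x dt`. -/
abbrev Event : Type := Space × ℝ

variable {F : Type*} [NormedAddCommGroup F] [NormedSpace ℝ F]

/-- The Lorenz kernel `K(z, τ) = δ(τ - |z| / C) / |z|` as a measure on space-time:
the image of `|z|⁻¹ d³z` under `z ↦ (z, |z| / C)`, so that
`∫ φ dK = ∫ φ(z, |z| / C) / |z| d³z`. -/
noncomputable def lorenzKernel (C : ℝ) : Measure Event :=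
  ((volume : Measure Space).withDensity fun z => ENNReal.ofReal ‖z‖⁻¹).map
    fun z => (z, ‖z‖ / C)

/-- The action of the kernel, `(K ∗ f)(x, t) = ∬ K(x - y, t - r) f(y, r) d³y dr`. -/
noncomputable def lorenzConv (C : ℝ) (f : Event → F) (q : Event) : F :=
  ∫ p, f (q - p) ∂(lorenzKernel C)

/-- The d'Alembert operator `□ = Δ - C⁻² ∂²/∂t²`. -/
noncomputable def dAlembert (C : ℝ) (u : Event → F) (q : Event) : F :=
  Laplacian.laplacian (fun x : Space => u (x, q.2)) q.1
    - (1 / C ^ 2) • iteratedDeriv 2 (fun t : ℝ => u (q.1, t)) q.2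

/-- Test functions on space-time: smooth real functions with compact support. -/
def IsTestFunction (φ : Event → ℝ) : Prop :=
  ContDiff ℝ ∞ φ ∧ HasCompactSupport φ

/-- `|u(x, t)| = O(|x|^(-p))` as `|x| → ∞`, inside every solid past light cone
`{t ≤ a - |x| / C}` (together these cones contain the past cone of every event).
Only the past of events is involved, so a function that vanishes before some time
qualifies as soon as it is continuous. -/
def BigODecay {G : Type*} [Norm G] (C p : ℝ) (u : Event → G) : Prop :=
  ∀ a : ℝ, ∃ M : ℝ, ∀ (x : Space) (t : ℝ), t ≤ a - ‖x‖ / C →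
    ‖u (x, t)‖ ≤ M * (1 + ‖x‖) ^ (-p)

/-- `|u(x, t)| = o(|x|^(-k))` as `|x| → ∞`, inside every solid past light cone. -/
def LittleODecay {G : Type*} [Norm G] (C : ℝ) (k : ℕ) (u : Event → G) : Prop :=
  ∀ a ε : ℝ, 0 < ε → ∃ R : ℝ, ∀ (x : Space) (t : ℝ), R ≤ ‖x‖ → t ≤ a - ‖x‖ / C →
    ‖x‖ ^ k * ‖u (x, t)‖ ≤ ε

/-- Sources to which `□ (K ∗ f)` applies classically: `C²` functions which, with their
derivatives of order at most two, decrease like a power `|x|^(-p)` with `p > 2`. -/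
def IsSource (C : ℝ) (f : Event → F) : Prop :=
  ContDiff ℝ 2 f ∧ ∃ p : ℝ, 2 < p ∧ ∀ k ≤ 2, BigODecay C p (iteratedFDeriv ℝ k f)

/-- Potentials to which the partial integrations apply: `C²` functions that tend to zero
and whose first derivatives decrease faster than `1 / |x|`. -/
def IsPotential (C : ℝ) (A : Event → F) : Prop :=
  ContDiff ℝ 2 A ∧ LittleODecay C 0 A ∧ LittleODecay C 1 (fderiv ℝ A)

/-- The domain of `K ∗` among locally integrable functions: the retarded integral of `|f|`
is locally integrable. -/
def InKernelDomain (C : ℝ) (f : Event → F) : Prop :=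
  LocallyIntegrable f volume ∧
    ∀ S : Set Event, IsCompact S →
      ∫⁻ q in S, ∫⁻ p, ‖f (q - p)‖ₑ ∂(lorenzKernel C) < ⊤

end LorenzWave

/-!
The four statements are one identity, Kirchhoff's formula at the origin
(`integral_dAlembert_lorenzKernel`): if `B` is `C²`, tends to zero along the future light cone of
the origin, and `∇B = o(1/|z|)` there, then `∫ □B dK = -4π B(0)` whenever the integral converges.

Write `[u](z) = u(z, |z|/C)`. Then `[□B] / |z|` is the divergence, away from the origin, of
`V = [∇B] / |z| + [B] z / |z|³ - [∂ₜB] z / (C |z|²)` (`sum_fderiv_coneField`). Integrating `div (η V)`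
for a radial cutoff `η` supported in an annulus gives `∫ η [□B] / |z| = -∫ η' V · z / |z|`. The cutoff
rises from `0` to `1` on a shell of radius `ε` and falls back to `0` on a shell of radius `R`; each
shell carries `|z|⁻² |η'|` with total mass `4π`, so that the inner one yields `-4π B(0)` as `ε → 0`
by continuity, and the outer one vanishes as `R → ∞` by the decay of `B` and `∇B`. Working with
cutoffs in place of spheres means that only the fundamental theorem of calculus in one radial
variable and the vanishing of `∫ ∂ᵢW` for compactly supported `W` are needed.

For a test function both decay conditions are trivial, which is `□K = -4πδ`. Applied to
`B(p) = A(q - p)` the formula gives `(K ∗ □A)(q) = -4π A(q)` for potentials. For a source `f`, the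
bound `O(|x|^(-p))` with `p > 2` makes `|z|⁻¹ f` and its derivatives uniformly integrable along
light cones, so `K ∗` commutes with two differentiations, and `□(K ∗ f) = K ∗ □f = -4π f` because `f`
is itself a potential. In the distributional statement, Fubini's theorem moves `K ∗` onto the test
function, where `□K = -4πδ` applies.
-/

namespace LorenzWave

variable {F : Type*} [NormedAddCommGroup F] [NormedSpace ℝ F]

/-! ### The d'Alembert operator as a linear function of the second derivative -/

/-- The `i`-th standard basis vector of space. -/
noncomputable def spaceBasis (i : Fin 3) : Space := EuclideanSpace.basisFun (Fin 3) ℝ i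

/-- The contraction of a bilinear form on space-time with the wave metric
`diag(1, 1, 1, -1/C²)`; applied to the second derivative of `u` it gives `□u`. -/
noncomputable def boxForm (C : ℝ) : (Event →L[ℝ] Event →L[ℝ] F) →L[ℝ] F :=
  ∑ i : Fin 3, (ContinuousLinearMap.apply ℝ F ((spaceBasis i, 0) : Event)) ∘L
      (ContinuousLinearMap.apply ℝ (Event →L[ℝ] F) ((spaceBasis i, 0) : Event))
    - (1 / C ^ 2) • (ContinuousLinearMap.apply ℝ F ((0, 1) : Event)) ∘L
      (ContinuousLinearMap.apply ℝ (Event →L[ℝ] F) ((0, 1) : Event))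

lemma boxForm_apply (C : ℝ) (T : Event →L[ℝ] Event →L[ℝ] F) :
    boxForm C T = ∑ i : Fin 3, T (spaceBasis i, 0) (spaceBasis i, 0)
      - (1 / C ^ 2) • T (0, 1) (0, 1) := by
  change ContinuousLinearMap.apply ℝ F T (boxForm C) = _
  rw [boxForm, map_sub, map_sum, map_smul]
  rfl

lemma fderiv_comp_affine {V : Type*} [NormedAddCommGroup V] [NormedSpace ℝ V]
    {u : Event → F} (hu : Differentiable ℝ u) (q : Event) (L : V →L[ℝ] Event) (s : V) :
    fderiv ℝ (fun s => u (q + L s)) s = (fderiv ℝ u (q + L s)).comp L :=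
  ((hu _).hasFDerivAt.comp s (L.hasFDerivAt.const_add q)).fderiv

lemma fderiv_fderiv_comp_affine {V : Type*} [NormedAddCommGroup V] [NormedSpace ℝ V]
    {u : Event → F} (hu : ContDiff ℝ 2 u) (q : Event) (L : V →L[ℝ] Event) (s v w : V) :
    fderiv ℝ (fderiv ℝ fun s => u (q + L s)) s v w
      = fderiv ℝ (fderiv ℝ u) (q + L s) (L v) (L w) := by
  have h1 : fderiv ℝ (fun s => u (q + L s)) = fun s => (fderiv ℝ u (q + L s)).comp L :=
    funext fun s => fderiv_comp_affine (hu.differentiable (by norm_num)) q L s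
  have h2 : Differentiable ℝ (fderiv ℝ u) :=
    (hu.fderiv_right (m := 1) (by norm_num)).differentiable (by norm_num)
  have h3 : HasFDerivAt (fun s => fderiv ℝ u (q + L s))
      ((fderiv ℝ (fderiv ℝ u) (q + L s)).comp L) s :=
    (h2 _).hasFDerivAt.comp s (L.hasFDerivAt.const_add q)
  rw [h1, (h3.clm_comp (hasFDerivAt_const L s)).fderiv]
  simp

lemma dAlembert_eq_boxForm (C : ℝ) {u : Event → F} (hu : ContDiff ℝ 2 u) (q : Event) :
    dAlembert C u q = boxForm C (fderiv ℝ (fderiv ℝ u) q) := by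
  rw [dAlembert, boxForm_apply, InnerProductSpace.laplacian_eq_iteratedFDeriv_orthonormalBasis _
    (EuclideanSpace.basisFun (Fin 3) ℝ), iteratedDeriv_eq_iteratedFDeriv]
  have hx : (fun x : Space => u (x, q.2))
      = fun x => u ((0, q.2) + ContinuousLinearMap.inl ℝ Space ℝ x) := by
    ext x; simp
  have ht : (fun t : ℝ => u (q.1, t))
      = fun t => u ((q.1, 0) + ContinuousLinearMap.inr ℝ Space ℝ t) := by
    ext x; simp
  simp only [iteratedFDeriv_two_apply, hx, ht, fderiv_fderiv_comp_affine hu]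
  simp [spaceBasis]

lemma continuous_fderiv_fderiv {u : Event → F} (hu : ContDiff ℝ 2 u) :
    Continuous (fderiv ℝ (fderiv ℝ u)) :=
  (hu.fderiv_right (m := 1) (by norm_num)).continuous_fderiv (by norm_num)

lemma continuous_dAlembert (C : ℝ) {u : Event → F} (hu : ContDiff ℝ 2 u) :
    Continuous (dAlembert C u) := by
  rw [funext (dAlembert_eq_boxForm C hu)]
  exact (boxForm C).continuous.comp (continuous_fderiv_fderiv hu)

/-- `□` commutes with translations. -/
lemma dAlembert_comp_add (C : ℝ) {u : Event → F} (hu : ContDiff ℝ 2 u) (q p : Event) :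
    dAlembert C (fun p => u (q + p)) p = dAlembert C u (q + p) := by
  have hu' : ContDiff ℝ 2 fun p => u (q + p) := hu.comp (contDiff_const.add contDiff_id)
  rw [dAlembert_eq_boxForm C hu, dAlembert_eq_boxForm C hu',
    boxForm_apply, boxForm_apply]
  have h := fderiv_fderiv_comp_affine hu q (ContinuousLinearMap.id ℝ Event) p
  simp only [ContinuousLinearMap.id_apply] at h
  simp only [h]

/-- `□` commutes with point reflections. -/
lemma dAlembert_comp_sub (C : ℝ) {u : Event → F} (hu : ContDiff ℝ 2 u) (q p : Event) :
    dAlembert C (fun p => u (q - p)) p = dAlembert C u (q - p) := by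
  have hu' : ContDiff ℝ 2 fun p => u (q - p) := hu.comp (contDiff_const.sub contDiff_id)
  rw [dAlembert_eq_boxForm C hu, dAlembert_eq_boxForm C hu',
    boxForm_apply, boxForm_apply]
  have h := fderiv_fderiv_comp_affine hu q (-ContinuousLinearMap.id ℝ Event) p
  simp only [_root_.neg_apply, ContinuousLinearMap.id_apply, ← sub_eq_add_neg] at h
  simp only [h, map_neg, _root_.neg_apply, neg_neg]

/-! ### The kernel as a weighted integral over space -/

/-- The point of the future light cone of the origin above `z`. -/
noncomputable def conePoint (C : ℝ) (z : Space) : Event := (z, ‖z‖ / C)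

lemma continuous_conePoint (C : ℝ) : Continuous (conePoint C) := by
  unfold conePoint; fun_prop

lemma measurable_ofReal_inv_norm : Measurable fun z : Space => ENNReal.ofReal ‖z‖⁻¹ := by
  fun_prop

instance (C : ℝ) : SFinite (lorenzKernel C) := by
  unfold lorenzKernel; infer_instance

lemma integral_lorenzKernel (C : ℝ) {g : Event → F}
    (hg : AEStronglyMeasurable g (lorenzKernel C)) :
    ∫ p, g p ∂(lorenzKernel C) = ∫ z, ‖z‖⁻¹ • g (conePoint C z) := by
  have hm : AEMeasurable (fun z : Space => (z, ‖z‖ / C))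
      ((volume : Measure Space).withDensity fun z => ENNReal.ofReal ‖z‖⁻¹) :=
    (continuous_conePoint C).measurable.aemeasurable
  unfold lorenzKernel at hg ⊢
  rw [integral_map hm hg, integral_withDensity_eq_integral_toReal_smul measurable_ofReal_inv_norm
    (by simp)]
  simp [conePoint]

lemma integrable_lorenzKernel_iff (C : ℝ) {g : Event → F}
    (hg : AEStronglyMeasurable g (lorenzKernel C)) :
    Integrable g (lorenzKernel C) ↔ Integrable fun z => ‖z‖⁻¹ • g (conePoint C z) := by
  have hm : AEMeasurable (fun z : Space => (z, ‖z‖ / C))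
      ((volume : Measure Space).withDensity fun z => ENNReal.ofReal ‖z‖⁻¹) :=
    (continuous_conePoint C).measurable.aemeasurable
  unfold lorenzKernel at hg ⊢
  rw [integrable_map_measure hg hm, integrable_withDensity_iff_integrable_smul'
    measurable_ofReal_inv_norm (by simp)]
  simp [conePoint]

lemma ae_lorenzKernel_of_cone (C : ℝ) {P : Event → Prop} (h : ∀ z, P (conePoint C z)) :
    ∀ᵐ p ∂(lorenzKernel C), P p := by
  have hcl : IsClosed (Set.range (conePoint C)) := by
    have : Set.range (conePoint C) = {p : Event | p.2 = ‖p.1‖ / C} := by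
      ext ⟨x, t⟩
      simp only [conePoint, Set.mem_range, Prod.mk.injEq, Set.mem_ofPred_eq]
      exact ⟨by rintro ⟨y, rfl, rfl⟩; rfl, fun h => ⟨x, rfl, h.symm⟩⟩
    rw [this]
    exact isClosed_eq (by fun_prop) (by fun_prop)
  have hr : ∀ᵐ p ∂(lorenzKernel C), p ∈ Set.range (conePoint C) :=
    (ae_map_iff (continuous_conePoint C).measurable.aemeasurable hcl.measurableSet).2
      (Eventually.of_forall fun z => ⟨z, rfl⟩)
  filter_upwards [hr]
  rintro _ ⟨z, rfl⟩
  exact h z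

/-- The radial weight `|z|⁻¹ (1 + |z|)^(-p)` is integrable on space exactly because `p > 2`. -/
lemma integrable_inv_norm_mul_rpow {p : ℝ} (hp : 2 < p) :
    Integrable fun z : Space => ‖z‖⁻¹ * (1 + ‖z‖) ^ (-p) := by
  rw [integrable_fun_norm_addHaar (volume : Measure Space)
    (f := fun r : ℝ => r⁻¹ * (1 + r) ^ (-p))]
  have h0 : IntegrableOn (fun r : ℝ => (r + 1) ^ (1 - p)) (Set.Ioi 0) :=
    integrableOn_add_rpow_Ioi_of_lt (by linarith) (by norm_num)
  refine h0.mono' ?_ ((ae_restrict_iff' measurableSet_Ioi).2 (Eventually.of_forall ?_))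
  · exact Measurable.aestronglyMeasurable (by fun_prop)
  · intro r hr
    have hr : 0 < r := hr
    have e : (1 + r) ^ (1 - p) = (1 + r) * (1 + r) ^ (-p) := by
      rw [sub_eq_add_neg, Real.rpow_add (by positivity), Real.rpow_one]
    rw [Real.norm_of_nonneg (by positivity), add_comm r 1, e]
    simp only [finrank_euclideanSpace, Fintype.card_fin, smul_eq_mul]
    have : r ^ (3 - 1) * (r⁻¹ * (1 + r) ^ (-p)) = r * (1 + r) ^ (-p) := by
      field_simp
    rw [this]
    gcongr
    linarith

lemma integrable_decay_lorenzKernel (C : ℝ) {p : ℝ} (hp : 2 < p) :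
    Integrable (fun e : Event => (1 + ‖e.1‖) ^ (-p)) (lorenzKernel C) := by
  rw [integrable_lorenzKernel_iff C (Measurable.aestronglyMeasurable (by fun_prop))]
  exact integrable_inv_norm_mul_rpow hp

lemma integrable_lorenzKernel_of_decay {G : Type*} [NormedAddCommGroup G] (C : ℝ) {p : ℝ}
    (hp : 2 < p) {g : Event → G}
    (hg : AEStronglyMeasurable g (lorenzKernel C)) (M : ℝ)
    (hM : ∀ z, ‖g (conePoint C z)‖ ≤ M * (1 + ‖z‖) ^ (-p)) :
    Integrable g (lorenzKernel C) :=
  ((integrable_decay_lorenzKernel C hp).const_mul M).mono' hg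
    (ae_lorenzKernel_of_cone C hM)

lemma integrable_lorenzKernel_of_hasCompactSupport (C : ℝ) {g : Event → F}
    (hg : Continuous g) (hc : HasCompactSupport g) : Integrable g (lorenzKernel C) := by
  have hd : Continuous fun p : Event => (1 + ‖p.1‖) ^ (3 : ℝ) • g p := by
    refine Continuous.smul (Continuous.rpow_const (by fun_prop) fun p => Or.inr (by norm_num)) hg
  obtain ⟨M, hM⟩ := hd.bounded_above_of_compact_support (hc.smul_left)
  refine integrable_lorenzKernel_of_decay C (p := 3) (by norm_num) hg.aestronglyMeasurable M
    fun z => ?_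
  have h := hM (conePoint C z)
  have hpos : 0 < (1 + ‖z‖) ^ (3 : ℝ) := by positivity
  rw [norm_smul, Real.norm_of_nonneg (by positivity)] at h
  rw [Real.rpow_neg (by positivity), ← div_eq_mul_inv, le_div_iff₀ hpos, mul_comm]
  exact h

/-! ### The divergence identity on the light cone -/

lemma integral_fderiv_eq_zero_of_hasCompactSupport {W : Space → F} (hW : ContDiff ℝ 1 W)
    (hc : HasCompactSupport W) (v : Space) :
    Integrable (fun z => fderiv ℝ W z v) ∧ ∫ z, fderiv ℝ W z v = 0 := by
  have hi : Integrable (fun z => fderiv ℝ W z v) :=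
    Continuous.integrable_of_hasCompactSupport
      ((hW.continuous_fderiv (by norm_num)).clm_apply continuous_const) (hc.fderiv_apply ℝ v)
  refine ⟨hi, ?_⟩
  have h := integral_smul_fderiv_eq_neg_fderiv_smul_of_integrable (μ := (volume : Measure Space))
    (f := fun _ : Space => (1 : ℝ)) (g := W) (v := v) (by simp) (by simpa using hi)
    (by simpa using hW.continuous.integrable_of_hasCompactSupport hc)
    (fun z _ => differentiableAt_const _) (fun z _ => hW.differentiable (by norm_num) z)
  simpa using h

/-- The `i`-th component of the field `η(|z|) V(z)`, where
`V = [∇B] / |z| + [B] z / |z|³ - [∂ₜB] z / (C |z|²)` and `[·]` is evaluation at `(z, |z|/C)`.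
Away from the origin `V` has divergence `[□B] / |z|`. -/
noncomputable def coneField (C : ℝ) (η : ℝ → ℝ) (B : Event → F) (i : Fin 3) (z : Space) : F :=
  (η ‖z‖ * ‖z‖⁻¹) • fderiv ℝ B (conePoint C z) (spaceBasis i, 0)
    + (η ‖z‖ * z i * ‖z‖⁻¹ ^ 3) • B (conePoint C z)
    - (η ‖z‖ * z i * ‖z‖⁻¹ ^ 2 / C) • fderiv ℝ B (conePoint C z) (0, 1)

/-- The flux density of `V` through the sphere of radius `|z|`, multiplied by `|z|²`:
`|z|² V(z) · z / |z| = [z · ∇B] + [B] - (|z| / C) [∂ₜB]`. -/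
noncomputable def coneFlux (C : ℝ) (B : Event → F) (z : Space) : F :=
  fderiv ℝ B (conePoint C z) (z, 0) + B (conePoint C z)
    - (‖z‖ / C) • fderiv ℝ B (conePoint C z) (0, 1)

lemma hasDerivAt_norm_add_smul {z : Space} (hz : z ≠ 0) (i : Fin 3) :
    HasDerivAt (fun s : ℝ => ‖z + s • spaceBasis i‖) (z i * ‖z‖⁻¹) 0 := by
  have h1 : HasDerivAt (fun s : ℝ => z + s • spaceBasis i) (spaceBasis i) 0 := by
    simpa using ((hasDerivAt_id (0 : ℝ)).smul_const (spaceBasis i)).const_add z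
  have h2 := h1.norm_sq.sqrt (by simpa using hz)
  simp only [Real.sqrt_sq (norm_nonneg _)] at h2
  refine h2.congr_deriv ?_
  have : inner ℝ z (spaceBasis i) = z i := by
    simp [spaceBasis, EuclideanSpace.inner_single_right]
  simp [this]
  field_simp

lemma hasDerivAt_conePoint_add_smul (C : ℝ) {z : Space} (hz : z ≠ 0) (i : Fin 3) :
    HasDerivAt (fun s : ℝ => conePoint C (z + s • spaceBasis i))
      ((spaceBasis i, 0) + (z i * ‖z‖⁻¹ / C) • ((0, 1) : Event)) 0 := by
  have h1 : HasDerivAt (fun s : ℝ => z + s • spaceBasis i) (spaceBasis i) 0 := by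
    simpa using ((hasDerivAt_id (0 : ℝ)).smul_const (spaceBasis i)).const_add z
  refine (h1.prodMk ((hasDerivAt_norm_add_smul hz i).div_const C)).congr_deriv ?_
  simp

lemma contDiffAt_coneField (C : ℝ) {η : ℝ → ℝ} (hη : ContDiff ℝ 1 η) {B : Event → F}
    (hB : ContDiff ℝ 2 B) (i : Fin 3) {z : Space} (hz : z ≠ 0) :
    ContDiffAt ℝ 1 (coneField C η B i) z := by
  have hn : ContDiffAt ℝ 1 (fun z : Space => ‖z‖) z := contDiffAt_norm ℝ hz
  have hN : ContDiffAt ℝ 1 (fun z : Space => ‖z‖⁻¹) z := hn.inv (by simpa using hz)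
  have he : ContDiffAt ℝ 1 (fun z : Space => η ‖z‖) z := hη.contDiffAt.comp z hn
  have hi : ContDiffAt ℝ 1 (fun z : Space => z i) z :=
    (EuclideanSpace.proj (𝕜 := ℝ) i : Space →L[ℝ] ℝ).contDiff.contDiffAt
  have hc : ContDiffAt ℝ 1 (conePoint C) z := contDiffAt_id.prodMk (hn.div_const C)
  have hb : ContDiffAt ℝ 1 (fun z => B (conePoint C z)) z :=
    (hB.of_le (by norm_num)).contDiffAt.comp z hc
  have hd : ContDiffAt ℝ 1 (fun z => fderiv ℝ B (conePoint C z)) z :=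
    (hB.fderiv_right (m := 1) (by norm_num)).contDiffAt.comp z hc
  exact (((he.mul hN).smul (hd.clm_apply contDiffAt_const)).add
    (((he.mul hi).mul (hN.pow 3)).smul hb)).sub
    ((((he.mul hi).mul (hN.pow 2)).div_const C).smul (hd.clm_apply contDiffAt_const))

/-- The derivative of the component `Wᵢ = coneField C η B i` in the direction `eᵢ`. -/
lemma hasDerivAt_coneField (C : ℝ) {η : ℝ → ℝ} (hη : ContDiff ℝ 1 η) {B : Event → F}
    (hB : ContDiff ℝ 2 B) (i : Fin 3) {z : Space} (hz : z ≠ 0) :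
    HasDerivAt (fun s : ℝ => coneField C η B i (z + s • spaceBasis i))
      ((deriv η ‖z‖ * z i * ‖z‖⁻¹ ^ 2 - η ‖z‖ * z i * ‖z‖⁻¹ ^ 3) •
          fderiv ℝ B (conePoint C z) (spaceBasis i, 0)
        + (η ‖z‖ * ‖z‖⁻¹) • (fderiv ℝ (fderiv ℝ B) (conePoint C z) (spaceBasis i, 0)
            (spaceBasis i, 0) + (z i * ‖z‖⁻¹ / C) •
            fderiv ℝ (fderiv ℝ B) (conePoint C z) (0, 1) (spaceBasis i, 0))
        + (deriv η ‖z‖ * z i ^ 2 * ‖z‖⁻¹ ^ 4 + η ‖z‖ * ‖z‖⁻¹ ^ 3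
            - 3 * η ‖z‖ * z i ^ 2 * ‖z‖⁻¹ ^ 5) • B (conePoint C z)
        + (η ‖z‖ * z i * ‖z‖⁻¹ ^ 3) • (fderiv ℝ B (conePoint C z) (spaceBasis i, 0)
            + (z i * ‖z‖⁻¹ / C) • fderiv ℝ B (conePoint C z) (0, 1))
        - ((deriv η ‖z‖ * z i ^ 2 * ‖z‖⁻¹ ^ 3 + η ‖z‖ * ‖z‖⁻¹ ^ 2
            - 2 * η ‖z‖ * z i ^ 2 * ‖z‖⁻¹ ^ 4) / C) • fderiv ℝ B (conePoint C z) (0, 1)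
        - (η ‖z‖ * z i * ‖z‖⁻¹ ^ 2 / C) • (fderiv ℝ (fderiv ℝ B) (conePoint C z)
            (spaceBasis i, 0) (0, 1) + (z i * ‖z‖⁻¹ / C) •
            fderiv ℝ (fderiv ℝ B) (conePoint C z) (0, 1) (0, 1))) 0 := by
  have e0 : z + (0 : ℝ) • spaceBasis i = z := by simp
  have hz' : ‖z‖ ≠ 0 := by simpa using hz
  have hn := hasDerivAt_norm_add_smul hz i
  have hc := hasDerivAt_conePoint_add_smul C hz i
  have hN : HasDerivAt (fun s : ℝ => ‖z + s • spaceBasis i‖⁻¹) (-(z i) * ‖z‖⁻¹ ^ 3) 0 := by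
    refine (hn.inv (by rw [e0]; exact hz')).congr_deriv ?_
    rw [e0]
    field_simp
  have he : HasDerivAt (fun s : ℝ => η ‖z + s • spaceBasis i‖)
      (deriv η ‖z‖ * (z i * ‖z‖⁻¹)) 0 := by
    refine HasDerivAt.comp (h₂ := η) (0 : ℝ) ?_ hn
    rw [e0]
    exact (hη.differentiable (by norm_num) _).hasDerivAt
  have hi : HasDerivAt (fun s : ℝ => (z + s • spaceBasis i) i) 1 0 := by
    simpa [spaceBasis] using (hasDerivAt_id (0 : ℝ)).const_add (z i)
  have hb : HasDerivAt (fun s : ℝ => B (conePoint C (z + s • spaceBasis i)))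
      (fderiv ℝ B (conePoint C z) ((spaceBasis i, 0) + (z i * ‖z‖⁻¹ / C) • ((0, 1) : Event))) 0 := by
    refine HasFDerivAt.comp_hasDerivAt (0 : ℝ) ?_ hc
    rw [e0]
    exact (hB.differentiable (by norm_num) _).hasFDerivAt
  have hd : HasDerivAt (fun s : ℝ => fderiv ℝ B (conePoint C (z + s • spaceBasis i)))
      (fderiv ℝ (fderiv ℝ B) (conePoint C z)
        ((spaceBasis i, 0) + (z i * ‖z‖⁻¹ / C) • ((0, 1) : Event))) 0 := by
    refine HasFDerivAt.comp_hasDerivAt (0 : ℝ) ?_ hc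
    rw [e0]
    exact ((hB.fderiv_right (m := 1) (by norm_num)).differentiable (by norm_num) _).hasFDerivAt
  have hdv (v : Event) := hd.clm_apply (hasDerivAt_const (0 : ℝ) v)
  refine ((((he.mul hN).smul (hdv (spaceBasis i, 0))).add
    (((he.mul hi).mul (hN.pow 3)).smul hb)).sub
    ((((he.mul hi).mul (hN.pow 2)).div_const C).smul (hdv (0, 1)))).congr_deriv ?_
  simp only [e0, map_add, map_smul, _root_.add_apply, _root_.smul_apply, map_zero, add_zero,
    Pi.mul_apply, Pi.pow_apply]
  push_cast
  module

/-- `div (η V) = η [□B] / |z| + η' |z|⁻² (|z|² V · z / |z|)`. -/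
lemma sum_fderiv_coneField (C : ℝ) {η : ℝ → ℝ} (hη : ContDiff ℝ 1 η) {B : Event → F}
    (hB : ContDiff ℝ 2 B) {z : Space} (hz : z ≠ 0) :
    ∑ i, fderiv ℝ (coneField C η B i) z (spaceBasis i)
      = (η ‖z‖ * ‖z‖⁻¹) • dAlembert C B (conePoint C z)
        + (deriv η ‖z‖ * ‖z‖⁻¹ ^ 2) • coneFlux C B z := by
  have hz' : ‖z‖ ≠ 0 := by simpa using hz
  have h1 (i : Fin 3) := (((contDiffAt_coneField C hη hB i hz).differentiableAt
    (by norm_num)).hasFDerivAt.hasLineDerivAt (spaceBasis i)).unique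
    (hasDerivAt_coneField C hη hB i hz)
  have hsymm (v w : Event) : fderiv ℝ (fderiv ℝ B) (conePoint C z) v w
      = fderiv ℝ (fderiv ℝ B) (conePoint C z) w v :=
    (hB.contDiffAt.isSymmSndFDerivAt (by simp)).eq v w
  have hS : (z 0 ^ 2 + z 1 ^ 2 + z 2 ^ 2) * ‖z‖⁻¹ ^ 2 = 1 := by
    have := EuclideanSpace.norm_sq_eq z
    simp only [Fin.sum_univ_three, Real.norm_eq_abs, sq_abs] at this
    rw [← this]
    field_simp
  have hzsum : ((z, 0) : Event) = z 0 • (spaceBasis 0, 0) + z 1 • (spaceBasis 1, 0)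
      + z 2 • (spaceBasis 2, 0) := by
    have : z = z 0 • spaceBasis 0 + z 1 • spaceBasis 1 + z 2 • spaceBasis 2 := by
      ext j
      fin_cases j <;> simp [spaceBasis]
    ext1
    · simpa using this
    · simp
  have hnn : ‖z‖⁻¹ ^ 2 * ‖z‖ = ‖z‖⁻¹ := by field_simp
  rw [Finset.sum_congr rfl fun i _ => h1 i, dAlembert_eq_boxForm C hB, boxForm_apply, coneFlux,
    hzsum]
  simp only [Fin.sum_univ_three, map_add, map_smul]
  rw [hsymm (0, 1) (spaceBasis 0, 0), hsymm (0, 1) (spaceBasis 1, 0),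
    hsymm (0, 1) (spaceBasis 2, 0)]
  generalize ‖z‖⁻¹ = N at *
  generalize fderiv ℝ (fderiv ℝ B) (conePoint C z) = D at *
  generalize fderiv ℝ B (conePoint C z) = G at *
  -- the coefficients agree up to multiples of `|z|⁻² (z₀² + z₁² + z₂²) - 1`
  linear_combination (norm := module) hS • ((deriv η ‖z‖ * N ^ 2 - 3 * η ‖z‖ * N ^ 3) • B (conePoint C z)
    - (η ‖z‖ * N / C ^ 2) • D (0, 1) (0, 1)
    + (C⁻¹ * (- deriv η ‖z‖ * N + 3 * η ‖z‖ * N ^ 2)) • G (0, 1))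
    + ((deriv η ‖z‖ * C⁻¹) * hnn) • G (0, 1)

/-- The divergence theorem for `η V`, which is `C¹` with compact support because `η` vanishes near the
origin and far out. -/
lemma integral_cutoff_divergence (C : ℝ) {η : ℝ → ℝ} (hη : ContDiff ℝ 1 η) {ε R : ℝ}
    (hε : 0 < ε) (h0 : ∀ r ≤ ε, η r = 0) (hR : ∀ r, R ≤ r → η r = 0) {B : Event → F}
    (hB : ContDiff ℝ 2 B) :
    ∫ z, ((η ‖z‖ * ‖z‖⁻¹) • dAlembert C B (conePoint C z)
        + (deriv η ‖z‖ * ‖z‖⁻¹ ^ 2) • coneFlux C B z) = 0 := by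
  have hW (i : Fin 3) : ContDiff ℝ 1 (coneField C η B i) := by
    refine contDiff_iff_contDiffAt.2 fun z => ?_
    rcases eq_or_ne z 0 with rfl | hz
    · refine (contDiffAt_const (c := (0 : F))).congr_of_eventuallyEq ?_
      filter_upwards [Metric.ball_mem_nhds (0 : Space) hε] with z hz
      have : η ‖z‖ = 0 := h0 _ (mem_ball_zero_iff.1 hz).le
      simp [coneField, this]
    · exact contDiffAt_coneField C hη hB i hz
  have hc (i : Fin 3) : HasCompactSupport (coneField C η B i) := by
    refine HasCompactSupport.intro (isCompact_closedBall (0 : Space) R) fun z hz => ?_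
    have : η ‖z‖ = 0 := hR _ (le_of_lt (by simpa using hz))
    simp [coneField, this]
  have hsum : ∫ z, ∑ i, fderiv ℝ (coneField C η B i) z (spaceBasis i) = 0 := by
    rw [integral_finsetSum _ fun i _ =>
      (integral_fderiv_eq_zero_of_hasCompactSupport (hW i) (hc i) _).1]
    exact Finset.sum_eq_zero fun i _ =>
      (integral_fderiv_eq_zero_of_hasCompactSupport (hW i) (hc i) _).2
  rw [← hsum]
  refine integral_congr_ae ?_
  have hne : ∀ᵐ z : Space, z ≠ 0 := by simp [ae_iff]
  filter_upwards [hne] with z hz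
  exact (sum_fderiv_coneField C hη hB hz).symm

/-! ### Radial cutoffs -/

/-- A smooth increasing step which is `0` on `(-∞, s]` and `1` on `[2s, ∞)`. -/
noncomputable def radialStep (s r : ℝ) : ℝ := Real.smoothTransition (r / s - 1)

lemma contDiff_radialStep (s : ℝ) : ContDiff ℝ 1 (radialStep s) :=
  (Real.smoothTransition.contDiff (n := 1)).comp ((contDiff_id.div_const s).sub contDiff_const)

lemma radialStep_eq_zero {s r : ℝ} (hs : 0 < s) (h : r ≤ s) : radialStep s r = 0 :=
  Real.smoothTransition.zero_of_nonpos (by linarith [(div_le_one hs).2 h])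

lemma radialStep_eq_one {s r : ℝ} (hs : 0 < s) (h : 2 * s ≤ r) : radialStep s r = 1 :=
  Real.smoothTransition.one_of_one_le (by linarith [(le_div_iff₀ hs).2 h])

lemma deriv_radialStep_nonneg {s : ℝ} (hs : 0 < s) (r : ℝ) : 0 ≤ deriv (radialStep s) r := by
  refine Monotone.deriv_nonneg fun a b hab => Real.smoothTransition.monotone ?_
  gcongr

lemma deriv_radialStep_of_lt {s r : ℝ} (hs : 0 < s) (h : r < s) : deriv (radialStep s) r = 0 := by
  have : radialStep s =ᶠ[𝓝 r] fun _ => 0 := by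
    filter_upwards [Iio_mem_nhds h] with x hx using radialStep_eq_zero hs (le_of_lt hx)
  rw [this.deriv_eq]
  simp

lemma deriv_radialStep_of_gt {s r : ℝ} (hs : 0 < s) (h : 2 * s < r) :
    deriv (radialStep s) r = 0 := by
  have : radialStep s =ᶠ[𝓝 r] fun _ => 1 := by
    filter_upwards [Ioi_mem_nhds h] with x hx using radialStep_eq_one hs (le_of_lt hx)
  rw [this.deriv_eq]
  simp

/-- The weight `|z|⁻² (d/dr) radialStep s` on the shell `s ≤ |z| ≤ 2s`, of total mass `4π`. -/
noncomputable def shellWeight (s : ℝ) (z : Space) : ℝ := deriv (radialStep s) ‖z‖ * ‖z‖⁻¹ ^ 2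

lemma shellWeight_nonneg {s : ℝ} (hs : 0 < s) (z : Space) : 0 ≤ shellWeight s z :=
  mul_nonneg (deriv_radialStep_nonneg hs _) (by positivity)

lemma shellWeight_eq_zero {s : ℝ} (hs : 0 < s) {z : Space} (h : ¬ (s ≤ ‖z‖ ∧ ‖z‖ ≤ 2 * s)) :
    shellWeight s z = 0 := by
  rw [shellWeight]
  by_cases h1 : s ≤ ‖z‖
  · rw [deriv_radialStep_of_gt hs (not_le.1 fun h2 => h ⟨h1, h2⟩), zero_mul]
  · rw [deriv_radialStep_of_lt hs (not_le.1 h1), zero_mul]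

lemma hasDerivAt_radialStep (s r : ℝ) : HasDerivAt (radialStep s) (deriv (radialStep s) r) r :=
  ((contDiff_radialStep s).differentiable (by norm_num) r).hasDerivAt

lemma tendsto_radialStep_atTop {s : ℝ} (hs : 0 < s) : Tendsto (radialStep s) atTop (𝓝 1) :=
  tendsto_const_nhds.congr' <| by
    filter_upwards [eventually_ge_atTop (2 * s)] with r hr using (radialStep_eq_one hs hr).symm

lemma integrable_shellWeight {s : ℝ} (hs : 0 < s) : Integrable (shellWeight s) := by
  have h := integrable_fun_norm_addHaar (volume : Measure Space)
    (f := fun r : ℝ => deriv (radialStep s) r * r⁻¹ ^ 2)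
  refine h.2 ?_
  have h1 : IntegrableOn (deriv (radialStep s)) (Set.Ioi 0) :=
    integrableOn_Ioi_deriv_of_nonneg' (fun x _ => hasDerivAt_radialStep s x)
      (fun x _ => deriv_radialStep_nonneg hs x) (tendsto_radialStep_atTop hs)
  refine h1.congr_fun (fun r hr => ?_) measurableSet_Ioi
  have hr : r ≠ 0 := (Set.mem_Ioi.1 hr).ne'
  simp
  field_simp

lemma integral_shellWeight {s : ℝ} (hs : 0 < s) : ∫ z, shellWeight s z = 4 * Real.pi := by
  have h := integral_fun_norm_addHaar (volume : Measure Space)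
    (fun r : ℝ => deriv (radialStep s) r * r⁻¹ ^ 2)
  have h1 : ∫ r in Set.Ioi (0 : ℝ), deriv (radialStep s) r = 1 - radialStep s 0 :=
    integral_Ioi_of_hasDerivAt_of_nonneg' (fun x _ => hasDerivAt_radialStep s x)
      (fun x _ => deriv_radialStep_nonneg hs x) (tendsto_radialStep_atTop hs)
  have h2 : ∫ r in Set.Ioi (0 : ℝ), r ^ (Module.finrank ℝ Space - 1) •
      (deriv (radialStep s) r * r⁻¹ ^ 2) = 1 := by
    rw [radialStep_eq_zero hs hs.le, sub_zero] at h1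
    rw [← h1]
    refine setIntegral_congr_fun measurableSet_Ioi fun r hr => ?_
    have hr : r ≠ 0 := (Set.mem_Ioi.1 hr).ne'
    simp
    field_simp
  have hv : (volume : Measure Space).real (Metric.ball 0 1) = 4 * Real.pi / 3 := by
    rw [measureReal_def, EuclideanSpace.volume_ball_fin_three]
    simp only [ENNReal.ofReal_one, one_pow, one_mul]
    rw [ENNReal.toReal_ofReal (by positivity)]
    ring
  rw [h2, hv] at h
  unfold shellWeight
  rw [h]
  simp
  ring

lemma integrable_shellWeight_smul {s : ℝ} (hs : 0 < s) {G : Space → F} (hG : Continuous G) :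
    Integrable fun z => shellWeight s z • G z := by
  obtain ⟨M, hM⟩ := (isCompact_closedBall (0 : Space) (2 * s)).exists_bound_of_continuousOn
    hG.continuousOn
  refine ((integrable_shellWeight hs).mul_const M).mono'
    ((integrable_shellWeight hs).aestronglyMeasurable.smul hG.aestronglyMeasurable)
    (Eventually.of_forall fun z => ?_)
  rw [norm_smul, Real.norm_of_nonneg (shellWeight_nonneg hs z)]
  by_cases h : s ≤ ‖z‖ ∧ ‖z‖ ≤ 2 * s
  · exact mul_le_mul_of_nonneg_left (hM z (by simpa using h.2)) (shellWeight_nonneg hs z)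
  · simp [shellWeight_eq_zero hs h]

section Complete

variable [CompleteSpace F]

lemma norm_integral_shellWeight_sub_le {s : ℝ} (hs : 0 < s) {G : Space → F} (hG : Continuous G)
    {L : F} {δ : ℝ} (h : ∀ z, s ≤ ‖z‖ → ‖z‖ ≤ 2 * s → ‖G z - L‖ ≤ δ) :
    ‖(∫ z, shellWeight s z • G z) - (4 * Real.pi) • L‖ ≤ 4 * Real.pi * δ := by
  rw [← integral_shellWeight hs, ← integral_smul_const, ← integral_sub
    (integrable_shellWeight_smul hs hG) ((integrable_shellWeight hs).smul_const L),
    ← integral_mul_const]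
  refine norm_integral_le_of_norm_le ((integrable_shellWeight hs).mul_const δ)
    (Eventually.of_forall fun z => ?_)
  rw [← smul_sub, norm_smul, Real.norm_of_nonneg (shellWeight_nonneg hs z)]
  by_cases hz : s ≤ ‖z‖ ∧ ‖z‖ ≤ 2 * s
  · exact mul_le_mul_of_nonneg_left (h z hz.1 hz.2) (shellWeight_nonneg hs z)
  · simp [shellWeight_eq_zero hs hz]

/-- Averages over shells converge as soon as the integrand converges uniformly on the shells. -/
lemma tendsto_integral_shellWeight {ι : Type*} {l : Filter ι} {s : ι → ℝ} (hs : ∀ i, 0 < s i)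
    {G : Space → F} (hG : Continuous G) {L : F}
    (h : ∀ δ > 0, ∀ᶠ i in l, ∀ z, s i ≤ ‖z‖ → ‖z‖ ≤ 2 * s i → ‖G z - L‖ ≤ δ) :
    Tendsto (fun i => ∫ z, shellWeight (s i) z • G z) l (𝓝 ((4 * Real.pi) • L)) := by
  refine Metric.tendsto_nhds.2 fun δ hδ => ?_
  have hπ := Real.pi_pos
  filter_upwards [h (δ / (8 * Real.pi)) (by positivity)] with i hi
  rw [dist_eq_norm]
  refine (norm_integral_shellWeight_sub_le (hs i) hG hi).trans_lt ?_
  have : 4 * Real.pi * (δ / (8 * Real.pi)) = δ / 2 := by field_simp; norm_num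
  linarith

/-! ### The retarded integral of `□B` -/

omit [CompleteSpace F] in
lemma continuous_coneFlux (C : ℝ) {B : Event → F} (hB : ContDiff ℝ 2 B) :
    Continuous (coneFlux C B) := by
  have hc := continuous_conePoint C
  have hd : Continuous fun z => fderiv ℝ B (conePoint C z) :=
    (hB.continuous_fderiv (by norm_num)).comp hc
  unfold coneFlux
  exact ((hd.clm_apply (by fun_prop)).add (hB.continuous.comp hc)).sub
    ((continuous_norm.div_const C).smul (hd.clm_apply continuous_const))

omit [CompleteSpace F] in
lemma norm_coneFlux_le {C : ℝ} (hC : 0 < C) (B : Event → F) (z : Space) :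
    ‖coneFlux C B z‖ ≤ ‖B (conePoint C z)‖
      + (1 + 1 / C) * (‖z‖ * ‖fderiv ℝ B (conePoint C z)‖) := by
  have h1 : ‖fderiv ℝ B (conePoint C z) (z, 0)‖ ≤ ‖fderiv ℝ B (conePoint C z)‖ * ‖z‖ := by
    simpa using (fderiv ℝ B (conePoint C z)).le_opNorm (z, 0)
  have h2 : ‖fderiv ℝ B (conePoint C z) (0, 1)‖ ≤ ‖fderiv ℝ B (conePoint C z)‖ := by
    simpa using (fderiv ℝ B (conePoint C z)).le_opNorm ((0, 1) : Event)
  have h3 : ‖(‖z‖ / C) • fderiv ℝ B (conePoint C z) (0, 1)‖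
      ≤ (‖z‖ / C) * ‖fderiv ℝ B (conePoint C z)‖ := by
    rw [norm_smul, Real.norm_of_nonneg (by positivity)]
    gcongr
  calc ‖coneFlux C B z‖ ≤ ‖fderiv ℝ B (conePoint C z)‖ * ‖z‖ + ‖B (conePoint C z)‖
        + (‖z‖ / C) * ‖fderiv ℝ B (conePoint C z)‖ :=
        (norm_sub_le _ _).trans (add_le_add ((norm_add_le _ _).trans (add_le_add_left h1 _)) h3)
    _ = _ := by ring

lemma tendsto_inner_shell (C : ℝ) {B : Event → F} (hB : ContDiff ℝ 2 B) {ι : Type*} {l : Filter ι}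
    {s : ι → ℝ} (hs : ∀ i, 0 < s i) (hl : Tendsto s l (𝓝 0)) :
    Tendsto (fun i => ∫ z, shellWeight (s i) z • coneFlux C B z) l
      (𝓝 ((4 * Real.pi) • B 0)) := by
  have hG := continuous_coneFlux C hB
  refine tendsto_integral_shellWeight hs hG fun δ hδ => ?_
  have hz0 : coneFlux C B 0 = B 0 := by
    have : conePoint C 0 = 0 := by simp [conePoint]
    simp only [coneFlux, this, norm_zero, zero_div, zero_smul, sub_zero]
    rw [Prod.mk_zero_zero, map_zero, zero_add]
  obtain ⟨ρ, hρ, h⟩ := Metric.continuousAt_iff.1 hG.continuousAt δ hδ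
  filter_upwards [hl.eventually_lt_const (half_pos hρ)] with i hi z _ hz
  have := h (x := z) (by rw [dist_zero_right]; linarith)
  rw [hz0, dist_eq_norm] at this
  exact this.le

lemma tendsto_outer_shell {C : ℝ} (hC : 0 < C) {B : Event → F} (hB : ContDiff ℝ 2 B)
    (h0 : ∀ ε > 0, ∃ R : ℝ, ∀ z, R ≤ ‖z‖ → ‖B (conePoint C z)‖ ≤ ε)
    (h1 : ∀ ε > 0, ∃ R : ℝ, ∀ z, R ≤ ‖z‖ → ‖z‖ * ‖fderiv ℝ B (conePoint C z)‖ ≤ ε)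
    {ι : Type*} {l : Filter ι} {s : ι → ℝ} (hs : ∀ i, 0 < s i) (hl : Tendsto s l atTop) :
    Tendsto (fun i => ∫ z, shellWeight (s i) z • coneFlux C B z) l (𝓝 0) := by
  rw [← smul_zero (4 * Real.pi)]
  refine tendsto_integral_shellWeight hs (continuous_coneFlux C hB) fun δ hδ => ?_
  have hk : 0 < 1 + 1 / C := by positivity
  obtain ⟨R0, hR0⟩ := h0 (δ / 2) (by positivity)
  obtain ⟨R1, hR1⟩ := h1 (δ / 2 / (1 + 1 / C)) (by positivity)
  filter_upwards [hl.eventually_ge_atTop R0, hl.eventually_ge_atTop R1] with i hi0 hi1 z hz _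
  have a0 := hR0 z (hi0.trans hz)
  have a1 := hR1 z (hi1.trans hz)
  rw [le_div_iff₀ hk] at a1
  rw [sub_zero]
  refine (norm_coneFlux_le hC B z).trans ?_
  linarith

/-- **Kirchhoff's formula at the origin.** If `B → 0` and `∇B = o(1/|z|)` along the light cone,
then `∫ □B dK = -4π B(0)`: the divergence identity is integrated against the cutoffs
`radialStep ε - radialStep R`; the inner shell contributes `-4π B(0)` as `ε → 0`, and the outer
shell nothing as `R → ∞`. -/
theorem integral_dAlembert_lorenzKernel {C : ℝ} (hC : 0 < C) {B : Event → F}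
    (hB : ContDiff ℝ 2 B)
    (h0 : ∀ ε > 0, ∃ R : ℝ, ∀ z, R ≤ ‖z‖ → ‖B (conePoint C z)‖ ≤ ε)
    (h1 : ∀ ε > 0, ∃ R : ℝ, ∀ z, R ≤ ‖z‖ → ‖z‖ * ‖fderiv ℝ B (conePoint C z)‖ ≤ ε)
    (hint : Integrable (dAlembert C B) (lorenzKernel C)) :
    ∫ p, dAlembert C B p ∂(lorenzKernel C) = -(4 * Real.pi) • B 0 := by
  have hm : AEStronglyMeasurable (dAlembert C B) (lorenzKernel C) :=
    (continuous_dAlembert C hB).aestronglyMeasurable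
  rw [integral_lorenzKernel C hm]
  rw [integrable_lorenzKernel_iff C hm] at hint
  have hG := continuous_coneFlux C hB
  set u : Space → F := fun z => ‖z‖⁻¹ • dAlembert C B (conePoint C z) with hu
  have hN (n : ℕ) : (0 : ℝ) < n + 1 := by positivity
  have hNi (n : ℕ) : (0 : ℝ) < ((n : ℝ) + 1)⁻¹ := inv_pos.2 (hN n)
  let η : ℕ → ℝ → ℝ := fun n r => radialStep ((n : ℝ) + 1)⁻¹ r - radialStep ((n : ℝ) + 1) r
  have hη (n : ℕ) : ContDiff ℝ 1 (η n) := (contDiff_radialStep _).sub (contDiff_radialStep _)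
  have hη1 (n : ℕ) (r : ℝ) : ‖η n r‖ ≤ 1 := by
    have a1 := Real.smoothTransition.nonneg (r / ((n : ℝ) + 1)⁻¹ - 1)
    have a2 := Real.smoothTransition.le_one (r / ((n : ℝ) + 1)⁻¹ - 1)
    have a3 := Real.smoothTransition.nonneg (r / ((n : ℝ) + 1) - 1)
    have a4 := Real.smoothTransition.le_one (r / ((n : ℝ) + 1) - 1)
    rw [Real.norm_eq_abs, abs_le]
    simp only [η, radialStep]
    constructor <;> linarith
  have hηd (n : ℕ) (r : ℝ) : deriv (η n) r
      = deriv (radialStep ((n : ℝ) + 1)⁻¹) r - deriv (radialStep ((n : ℝ) + 1)) r :=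
    ((hasDerivAt_radialStep _ r).sub (hasDerivAt_radialStep _ r)).deriv
  have hle (n : ℕ) : ((n : ℝ) + 1)⁻¹ ≤ (n : ℝ) + 1 := by
    have : (1 : ℝ) ≤ n + 1 := by linarith [(Nat.cast_nonneg n : (0 : ℝ) ≤ n)]
    exact (inv_le_one_of_one_le₀ this).trans this
  have hm1 (n : ℕ) : AEStronglyMeasurable (fun z : Space => η n ‖z‖ • u z) :=
    (((hη n).continuous.comp continuous_norm).aestronglyMeasurable).smul hint.aestronglyMeasurable
  have hb1 (n : ℕ) (z : Space) : ‖η n ‖z‖ • u z‖ ≤ ‖u z‖ := by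
    rw [norm_smul]
    exact mul_le_of_le_one_left (norm_nonneg _) (hη1 n _)
  have hi1 (n : ℕ) : Integrable fun z : Space => η n ‖z‖ • u z :=
    hint.norm.mono' (hm1 n) (Eventually.of_forall (hb1 n))
  have key (n : ℕ) : ∫ z, η n ‖z‖ • u z
      = (∫ z, shellWeight ((n : ℝ) + 1) z • coneFlux C B z)
        - ∫ z, shellWeight ((n : ℝ) + 1)⁻¹ z • coneFlux C B z := by
    have h := integral_cutoff_divergence C (hη n) (hNi n)
      (fun r hr => by
        simp only [η]
        rw [radialStep_eq_zero (hNi n) hr, radialStep_eq_zero (hN n) (hr.trans (hle n)), sub_zero])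
      (R := 2 * ((n : ℝ) + 1))
      (fun r hr => by
        simp only [η]
        rw [radialStep_eq_one (hNi n) (le_trans (by linarith [hle n]) hr),
          radialStep_eq_one (hN n) hr, sub_self]) hB
    have e : ∀ z : Space, (η n ‖z‖ * ‖z‖⁻¹) • dAlembert C B (conePoint C z)
        + (deriv (η n) ‖z‖ * ‖z‖⁻¹ ^ 2) • coneFlux C B z
        = η n ‖z‖ • u z + (shellWeight ((n : ℝ) + 1)⁻¹ z • coneFlux C B z
          - shellWeight ((n : ℝ) + 1) z • coneFlux C B z) := fun z => by
      rw [hηd, hu, shellWeight, shellWeight]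
      module
    simp only [e] at h
    have hi2 : Integrable fun z => shellWeight ((n : ℝ) + 1)⁻¹ z • coneFlux C B z
        - shellWeight ((n : ℝ) + 1) z • coneFlux C B z :=
      (integrable_shellWeight_smul (hNi n) hG).sub (integrable_shellWeight_smul (hN n) hG)
    rw [integral_add (hi1 n) hi2, integral_sub
      (integrable_shellWeight_smul (hNi n) hG) (integrable_shellWeight_smul (hN n) hG)] at h
    rw [eq_neg_of_add_eq_zero_left h, neg_sub]
  have hlim : Tendsto (fun n => ∫ z, η n ‖z‖ • u z) atTop (𝓝 (∫ z, u z)) := by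
    refine tendsto_integral_of_dominated_convergence (fun z => ‖u z‖) hm1 hint.norm
      (fun n => Eventually.of_forall (hb1 n)) ?_
    have hne : ∀ᵐ z : Space, z ≠ 0 := by simp [ae_iff]
    filter_upwards [hne] with z hz
    have hz : 0 < ‖z‖ := norm_pos_iff.2 hz
    refine tendsto_const_nhds.congr' ?_
    have ht : Tendsto (fun n : ℕ => (n : ℝ)) atTop atTop := tendsto_natCast_atTop_atTop
    filter_upwards [ht.eventually_ge_atTop ‖z‖, ht.eventually_ge_atTop (2 / ‖z‖)] with n hn1 hn2
    have hs1 : radialStep ((n : ℝ) + 1)⁻¹ ‖z‖ = 1 := by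
      refine radialStep_eq_one (hNi n) ?_
      rw [← div_eq_mul_inv, div_le_iff₀ (hN n)]
      rw [div_le_iff₀ hz] at hn2
      nlinarith
    have hs2 : radialStep ((n : ℝ) + 1) ‖z‖ = 0 := radialStep_eq_zero (hN n) (by linarith)
    simp [η, hs1, hs2]
  have hin := tendsto_inner_shell C hB hNi (l := atTop) <|
    tendsto_inv_atTop_zero.comp (tendsto_atTop_add_const_right _ 1 tendsto_natCast_atTop_atTop)
  have hout := tendsto_outer_shell hC hB h0 h1 hN (l := atTop) <|
    tendsto_atTop_add_const_right _ 1 tendsto_natCast_atTop_atTop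
  have hlim' := (hout.sub hin).congr fun n => (key n).symm
  rw [tendsto_nhds_unique hlim hlim', zero_sub, neg_smul]

end Complete

/-! ### The kernel as a fundamental solution -/

lemma exists_conePoint_eq_zero_of_hasCompactSupport {G : Type*} [Zero G] (C : ℝ) {g : Event → G}
    (hg : HasCompactSupport g) : ∃ R : ℝ, ∀ z, R ≤ ‖z‖ → g (conePoint C z) = 0 := by
  obtain ⟨r, hr⟩ := hg.isCompact.isBounded.subset_closedBall 0
  refine ⟨r + 1, fun z hz => image_eq_zero_of_notMem_tsupport fun hmem => ?_⟩
  have h1 : ‖conePoint C z‖ ≤ r := by simpa using hr hmem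
  have h2 : ‖z‖ ≤ ‖conePoint C z‖ := norm_fst_le (conePoint C z)
  linarith

lemma hasCompactSupport_dAlembert (C : ℝ) {φ : Event → F} (h : ContDiff ℝ 2 φ)
    (hc : HasCompactSupport φ) : HasCompactSupport (dAlembert C φ) := by
  rw [funext (dAlembert_eq_boxForm C h)]
  have h2 : HasCompactSupport (fderiv ℝ (fderiv ℝ φ)) :=
    HasCompactSupport.fderiv ℝ (HasCompactSupport.fderiv ℝ hc)
  exact h2.comp_left (g := boxForm C) (map_zero _)

lemma IsTestFunction.contDiff_two {φ : Event → ℝ} (h : IsTestFunction φ) : ContDiff ℝ 2 φ :=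
  h.1.of_le (WithTop.coe_le_coe.2 (le_top : (2 : ℕ∞) ≤ ⊤))

theorem IsTestFunction.integral_dAlembert {C : ℝ} (hC : 0 < C) {φ : Event → ℝ}
    (h : IsTestFunction φ) :
    Integrable (dAlembert C φ) (lorenzKernel C) ∧
      ∫ p, dAlembert C φ p ∂(lorenzKernel C) = -(4 * Real.pi) * φ 0 := by
  have h2 := h.contDiff_two
  have hint : Integrable (dAlembert C φ) (lorenzKernel C) :=
    integrable_lorenzKernel_of_hasCompactSupport C (continuous_dAlembert C h2)
      (hasCompactSupport_dAlembert C h2 h.2)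
  obtain ⟨R0, hR0⟩ := exists_conePoint_eq_zero_of_hasCompactSupport C h.2
  obtain ⟨R1, hR1⟩ := exists_conePoint_eq_zero_of_hasCompactSupport C
    (HasCompactSupport.fderiv ℝ h.2)
  refine ⟨hint, integral_dAlembert_lorenzKernel hC h2 (fun ε hε => ⟨R0, fun z hz => ?_⟩)
    (fun ε hε => ⟨R1, fun z hz => ?_⟩) hint⟩
  · simpa [hR0 z hz] using hε.le
  · simpa [hR1 z hz] using hε.le

lemma IsTestFunction.comp_add {φ : Event → ℝ} (h : IsTestFunction φ) (q : Event) :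
    IsTestFunction fun p => φ (q + p) :=
  ⟨h.1.comp (contDiff_const.add contDiff_id), h.2.comp_homeomorph (Homeomorph.addLeft q)⟩

lemma IsTestFunction.integral_dAlembert_add {C : ℝ} (hC : 0 < C) {φ : Event → ℝ}
    (h : IsTestFunction φ) (q : Event) :
    ∫ p, dAlembert C φ (q + p) ∂(lorenzKernel C) = -(4 * Real.pi) * φ q := by
  have := ((h.comp_add q).integral_dAlembert hC).2
  simpa only [dAlembert_comp_add C h.contDiff_two, add_zero] using this

/-! ### Distributional solutions -/

instance : (volume : Measure Event).IsAddRightInvariant := by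
  rw [Measure.volume_eq_prod]
  infer_instance

omit [NormedSpace ℝ F] in
lemma InKernelDomain.integrable_prod {C : ℝ} {f : Event → F} (hf : InKernelDomain C f)
    {S : Set Event} (hS : IsCompact S) :
    Integrable (fun x : Event × Event => f (x.1 - x.2))
      ((volume.restrict S).prod (lorenzKernel C)) := by
  have hm : AEStronglyMeasurable (fun x : Event × Event => f (x.1 - x.2))
      ((volume : Measure Event).prod (lorenzKernel C)) :=
    hf.1.aestronglyMeasurable.comp_quasiMeasurePreserving
      (quasiMeasurePreserving_sub_of_right_invariant volume (lorenzKernel C))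
  have hm' := hm.mono_ac (Measure.AbsolutelyContinuous.prod
    (Measure.restrict_le_self (s := S)).absolutelyContinuous
    (Measure.AbsolutelyContinuous.refl (lorenzKernel C)))
  refine ⟨hm', ?_⟩
  rw [hasFiniteIntegral_iff_enorm, lintegral_prod _ hm'.enorm]
  exact hf.2 S hS

omit [NormedSpace ℝ F] in
lemma InKernelDomain.ae_integrable {C : ℝ} {f : Event → F} (hf : InKernelDomain C f) :
    ∀ᵐ q : Event, Integrable (fun p => f (q - p)) (lorenzKernel C) := by
  have h (n : ℕ) : ∀ᵐ q : Event, q ∈ Metric.closedBall (0 : Event) n →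
      Integrable (fun p => f (q - p)) (lorenzKernel C) :=
    (ae_restrict_iff' Metric.isClosed_closedBall.measurableSet).1
      (hf.integrable_prod (isCompact_closedBall 0 (n : ℝ))).prod_right_ae
  filter_upwards [ae_all_iff.2 h] with q hq
  obtain ⟨n, hn⟩ := exists_nat_ge ‖q‖
  exact hq n (by simpa using hn)

lemma InKernelDomain.locallyIntegrable_lorenzConv {C : ℝ} {f : Event → F}
    (hf : InKernelDomain C f) : LocallyIntegrable (lorenzConv C f) volume :=
  locallyIntegrable_iff.2 fun _ hS => (hf.integrable_prod hS).integral_prod_left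

/-- Transposition: moving `□` and `K ∗` onto the test function by Fubini's theorem leaves the
pairing of `□φ(y + ·)` with the kernel, which is `-4π φ(y)`. -/
theorem InKernelDomain.integral_dAlembert_smul_lorenzConv [CompleteSpace F] {C : ℝ} (hC : 0 < C)
    {f : Event → F} (hf : InKernelDomain C f) {φ : Event → ℝ} (hφ : IsTestFunction φ) :
    ∫ q, dAlembert C φ q • lorenzConv C f q = -(4 * Real.pi) • ∫ q, φ q • f q := by
  set ψ := dAlembert C φ with hψ
  have hψc : Continuous ψ := continuous_dAlembert C hφ.contDiff_two
  have hψs : HasCompactSupport ψ := hasCompactSupport_dAlembert C hφ.contDiff_two hφ.2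
  let Φ : Event × Event → F := fun x => ψ x.1 • f (x.1 - x.2)
  have hΦ : Integrable Φ ((volume : Measure Event).prod (lorenzKernel C)) := by
    obtain ⟨M, hM⟩ := hψc.bounded_above_of_compact_support hψs
    have h1 : Integrable Φ ((volume.restrict (tsupport ψ)).prod (lorenzKernel C)) :=
      (hf.integrable_prod hψs.isCompact).bdd_smul M
        (hψc.comp continuous_fst).aestronglyMeasurable (Eventually.of_forall fun x => hM x.1)
    have h2 : (volume.restrict (tsupport ψ)).prod (lorenzKernel C)
        = ((volume : Measure Event).prod (lorenzKernel C)).restrict (tsupport ψ ×ˢ Set.univ) := by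
      rw [← Measure.prod_restrict, Measure.restrict_univ]
    rw [h2] at h1
    refine (integrableOn_iff_integrable_of_support_subset fun x hx => ?_).1 h1
    refine ⟨subset_tsupport ψ fun h0 => hx ?_, Set.mem_univ _⟩
    simp [Φ, h0]
  have hT : MeasurePreserving (fun x : Event × Event => (x.1 + x.2, x.2))
      ((volume : Measure Event).prod (lorenzKernel C))
      ((volume : Measure Event).prod (lorenzKernel C)) :=
    measurePreserving_add_prod volume (lorenzKernel C)
  have hΦT : Integrable (fun x : Event × Event => Φ (x.1 + x.2, x.2))
      ((volume : Measure Event).prod (lorenzKernel C)) :=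
    hT.integrable_comp_of_integrable hΦ
  have hswap : ∫ x, Φ x ∂((volume : Measure Event).prod (lorenzKernel C))
      = ∫ x, Φ (x.1 + x.2, x.2) ∂((volume : Measure Event).prod (lorenzKernel C)) := by
    have h := integral_map hT.aemeasurable (f := Φ) (by rw [hT.map_eq]; exact hΦ.1)
    rwa [hT.map_eq] at h
  rw [integral_prod _ hΦ, integral_prod _ hΦT] at hswap
  simp only [Φ, integral_smul, add_sub_cancel_right, integral_smul_const] at hswap
  simp only [hψ, hφ.integral_dAlembert_add hC] at hswap
  rw [← integral_smul]
  simp only [mul_smul] at hswap ⊢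
  exact hswap

/-! ### Potentials vanishing at infinity -/

lemma norm_fderiv_comp_sub {A : Event → F} (hA : Differentiable ℝ A) (q p : Event) :
    ‖fderiv ℝ (fun p => A (q - p)) p‖ = ‖fderiv ℝ A (q - p)‖ := by
  have h := fderiv_comp_affine hA q (-ContinuousLinearMap.id ℝ Event) p
  simp only [_root_.neg_apply, ContinuousLinearMap.id_apply, ← sub_eq_add_neg] at h
  rw [h, ContinuousLinearMap.comp_neg, ContinuousLinearMap.comp_id, norm_neg]

/-- The past light cone of `q` lies in the solid cone with `a = t + |x| / C`. -/
lemma sub_conePoint_snd_le {C : ℝ} (hC : 0 < C) (q : Event) (z : Space) :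
    q.2 - ‖z‖ / C ≤ (q.2 + ‖q.1‖ / C) - ‖q.1 - z‖ / C := by
  have : ‖q.1 - z‖ / C ≤ (‖q.1‖ + ‖z‖) / C := by gcongr; exact norm_sub_le _ _
  rw [add_div] at this
  linarith

theorem IsPotential.lorenzConv_dAlembert [CompleteSpace F] {C : ℝ} (hC : 0 < C) {A : Event → F}
    (hA : IsPotential C A) (q : Event)
    (hint : Integrable (fun p => dAlembert C A (q - p)) (lorenzKernel C)) :
    lorenzConv C (dAlembert C A) q = -(4 * Real.pi) • A q := by
  obtain ⟨hA2, hA0, hA1⟩ := hA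
  have hB : ContDiff ℝ 2 fun p => A (q - p) := hA2.comp (contDiff_const.sub contDiff_id)
  have hbox : dAlembert C (fun p => A (q - p)) = fun p => dAlembert C A (q - p) :=
    funext (dAlembert_comp_sub C hA2 q)
  have hnorm (z : Space) : ‖z‖ - ‖q.1‖ ≤ ‖q.1 - z‖ := by
    rw [norm_sub_rev]; exact norm_sub_norm_le z q.1
  have key := integral_dAlembert_lorenzKernel hC hB (fun ε hε => ?_) (fun ε hε => ?_)
    (by rwa [hbox])
  · rwa [hbox, sub_zero] at key
  · obtain ⟨R, hR⟩ := hA0 (q.2 + ‖q.1‖ / C) ε hε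
    refine ⟨R + ‖q.1‖, fun z hz => ?_⟩
    simpa only [pow_zero, one_mul] using! hR (q.1 - z) (q.2 - ‖z‖ / C) (by linarith [hnorm z])
      (sub_conePoint_snd_le hC q z)
  · obtain ⟨R, hR⟩ := hA1 (q.2 + ‖q.1‖ / C) (ε / 2) (by positivity)
    refine ⟨max (R + ‖q.1‖) (2 * ‖q.1‖), fun z hz => ?_⟩
    have hz1 := (le_max_left _ _).trans hz
    have hz2 := (le_max_right _ _).trans hz
    have h := hR (q.1 - z) (q.2 - ‖z‖ / C) (by linarith [hnorm z]) (sub_conePoint_snd_le hC q z)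
    rw [norm_fderiv_comp_sub (hA2.differentiable (by norm_num))]
    have e : q - conePoint C z = (q.1 - z, q.2 - ‖z‖ / C) := rfl
    rw [e]
    -- far out, `|z| ≤ 2 |x - z|`
    have h2 : ‖z‖ ≤ 2 * ‖q.1 - z‖ := by linarith [hnorm z]
    rw [pow_one] at h
    calc ‖z‖ * ‖fderiv ℝ A (q.1 - z, q.2 - ‖z‖ / C)‖
        ≤ 2 * ‖q.1 - z‖ * ‖fderiv ℝ A (q.1 - z, q.2 - ‖z‖ / C)‖ := by gcongr
      _ ≤ ε := by linarith

/-! ### Classical solutions for decaying sources -/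

lemma BigODecay.littleODecay {G : Type*} [NormedAddCommGroup G] {C p : ℝ} (hp : 2 < p)
    {u : Event → G} (hu : BigODecay C p u) {k : ℕ} (hk : k ≤ 1) : LittleODecay C k u := by
  intro a ε hε
  obtain ⟨M, hM⟩ := hu a
  refine ⟨|M| / ε, fun x t hx ht => ?_⟩
  have h1 : (1 : ℝ) ≤ 1 + ‖x‖ := by linarith [norm_nonneg x]
  have hpos : 0 < 1 + ‖x‖ := by linarith
  have h2 : ‖u (x, t)‖ ≤ |M| * (1 + ‖x‖) ^ (-(2 : ℝ)) := by
    refine (hM x t ht).trans (mul_le_mul (le_abs_self M) ?_ (by positivity) (abs_nonneg M))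
    exact Real.rpow_le_rpow_of_exponent_le h1 (by linarith)
  have h3 : ‖x‖ ^ k ≤ 1 + ‖x‖ := by
    interval_cases k <;> simp
  rw [Real.rpow_neg hpos.le, Real.rpow_two] at h2
  rw [div_le_iff₀ hε] at hx
  calc ‖x‖ ^ k * ‖u (x, t)‖ ≤ (1 + ‖x‖) * (|M| * ((1 + ‖x‖) ^ 2)⁻¹) := by gcongr
    _ = |M| / (1 + ‖x‖) := by field_simp
    _ ≤ ε := by
      rw [div_le_iff₀ hpos]
      nlinarith

/-- Decay is uniform on the past light cones of events near `q₀`. -/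
lemma BigODecay.exists_bound_near {G : Type*} [NormedAddCommGroup G] {C p : ℝ} (hC : 0 < C)
    (hp : 2 < p) {u : Event → G} (hu : BigODecay C p u) (q₀ : Event) :
    ∃ M : ℝ, ∀ q ∈ Metric.ball q₀ 1, ∀ z,
      ‖u (q - conePoint C z)‖ ≤ M * (1 + ‖z‖) ^ (-p) := by
  obtain ⟨M, hM⟩ := hu ((q₀.2 + 1) + (‖q₀.1‖ + 1) / C)
  refine ⟨|M| * (2 + ‖q₀.1‖) ^ p, fun q hq z => ?_⟩
  have hq' : ‖q - q₀‖ < 1 := by simpa [dist_eq_norm] using hq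
  have hq1 : ‖q.1‖ ≤ ‖q₀.1‖ + 1 := by
    have h1 : ‖q.1 - q₀.1‖ ≤ ‖q - q₀‖ := norm_fst_le (q - q₀)
    linarith [norm_sub_norm_le q.1 q₀.1]
  have hq2 : q.2 ≤ q₀.2 + 1 := by
    have h1 : ‖q.2 - q₀.2‖ ≤ ‖q - q₀‖ := norm_snd_le (q - q₀)
    rw [Real.norm_eq_abs] at h1
    linarith [le_abs_self (q.2 - q₀.2)]
  have h := hM (q.1 - z) (q.2 - ‖z‖ / C) <| by
    refine (sub_conePoint_snd_le hC q z).trans ?_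
    have : ‖q.1‖ / C ≤ (‖q₀.1‖ + 1) / C := by gcongr
    linarith
  have e : q - conePoint C z = (q.1 - z, q.2 - ‖z‖ / C) := rfl
  rw [e]
  have hz : 1 + ‖z‖ ≤ (2 + ‖q₀.1‖) * (1 + ‖q.1 - z‖) := by
    have h1 : ‖z‖ ≤ ‖q.1‖ + ‖q.1 - z‖ := by
      have := norm_sub_le q.1 (q.1 - z)
      rwa [sub_sub_cancel] at this
    nlinarith [norm_nonneg q₀.1, norm_nonneg (q.1 - z)]
  have hr : (1 + ‖q.1 - z‖) ^ (-p) ≤ (2 + ‖q₀.1‖) ^ p * (1 + ‖z‖) ^ (-p) := by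
    have h1 : (1 + ‖z‖) ^ p ≤ (2 + ‖q₀.1‖) ^ p * (1 + ‖q.1 - z‖) ^ p := by
      rw [← Real.mul_rpow (by positivity) (by positivity)]
      exact Real.rpow_le_rpow (by positivity) hz (by linarith)
    have a1 : 0 < (1 + ‖q.1 - z‖) ^ p := by positivity
    have a2 : 0 < (1 + ‖z‖) ^ p := by positivity
    rw [Real.rpow_neg (by positivity), Real.rpow_neg (by positivity), ← div_eq_mul_inv,
      le_div_iff₀ a2, inv_mul_le_iff₀ a1, mul_comm]
    exact h1
  calc ‖u (q.1 - z, q.2 - ‖z‖ / C)‖ ≤ M * (1 + ‖q.1 - z‖) ^ (-p) := h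
    _ ≤ |M| * (1 + ‖q.1 - z‖) ^ (-p) := by gcongr; exact le_abs_self M
    _ ≤ |M| * ((2 + ‖q₀.1‖) ^ p * (1 + ‖z‖) ^ (-p)) := by gcongr
    _ = _ := by ring

lemma BigODecay.integrable {G : Type*} [NormedAddCommGroup G] {C p : ℝ} (hC : 0 < C)
    (hp : 2 < p) {u : Event → G} (hc : Continuous u) (hu : BigODecay C p u) (q : Event) :
    Integrable (fun r => u (q - r)) (lorenzKernel C) := by
  obtain ⟨M, hM⟩ := hu.exists_bound_near hC hp q
  exact integrable_lorenzKernel_of_decay C hp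
    (hc.comp (continuous_const.sub continuous_id)).aestronglyMeasurable M
    (hM q (Metric.mem_ball_self one_pos))

lemma BigODecay.continuous_lorenzConv {C p : ℝ} (hC : 0 < C)
    (hp : 2 < p) {u : Event → F} (hc : Continuous u) (hu : BigODecay C p u) :
    Continuous (lorenzConv C u) := by
  refine continuous_iff_continuousAt.2 fun q₀ => ?_
  obtain ⟨M, hM⟩ := hu.exists_bound_near hC hp q₀
  refine continuousAt_of_dominated (bound := fun r => M * (1 + ‖r.1‖) ^ (-p))
    (Eventually.of_forall fun q => (hu.integrable hC hp hc q).1) ?_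
    ((integrable_decay_lorenzKernel C hp).const_mul M)
    (Eventually.of_forall fun r => (hc.comp (continuous_id.sub continuous_const)).continuousAt)
  filter_upwards [Metric.ball_mem_nhds q₀ one_pos] with q hq
  exact ae_lorenzKernel_of_cone C (hM q hq)

/-- `K ∗` commutes with differentiation. -/
lemma hasFDerivAt_lorenzConv {C p : ℝ} (hC : 0 < C) (hp : 2 < p) {u : Event → F}
    (hc : ContDiff ℝ 1 u) (hu : BigODecay C p u) (hu' : BigODecay C p (fderiv ℝ u)) (q₀ : Event) :
    HasFDerivAt (lorenzConv C u) (lorenzConv C (fderiv ℝ u) q₀) q₀ := by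
  obtain ⟨M, hM⟩ := hu'.exists_bound_near hC hp q₀
  refine hasFDerivAt_integral_of_dominated_of_fderiv_le (s := Metric.ball q₀ 1)
    (F := fun q r => u (q - r)) (F' := fun q r => fderiv ℝ u (q - r))
    (bound := fun r => M * (1 + ‖r.1‖) ^ (-p)) (Metric.ball_mem_nhds q₀ one_pos)
    (Eventually.of_forall fun q => (hu.integrable hC hp hc.continuous q).1)
    (hu.integrable hC hp hc.continuous q₀)
    (hu'.integrable hC hp (hc.continuous_fderiv (by norm_num)) q₀).1
    (ae_lorenzKernel_of_cone C fun z q hq => hM q hq z)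
    ((integrable_decay_lorenzKernel C hp).const_mul M)
    (Eventually.of_forall fun r q _ => ?_)
  exact ((hc.differentiable (by norm_num) (q - r)).hasFDerivAt.comp q
    ((hasFDerivAt_id q).sub_const r)).congr_fderiv (ContinuousLinearMap.comp_id _)

lemma IsSource.exists_decay {C : ℝ} {f : Event → F} (hf : IsSource C f) :
    ∃ p : ℝ, 2 < p ∧ BigODecay C p f ∧ BigODecay C p (fderiv ℝ f) ∧
      BigODecay C p (fderiv ℝ (fderiv ℝ f)) := by
  obtain ⟨p, hp, h⟩ := hf.2
  refine ⟨p, hp, ?_, ?_, ?_⟩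
  · simpa only [BigODecay, norm_iteratedFDeriv_zero] using h 0 (by norm_num)
  · simpa only [BigODecay, norm_iteratedFDeriv_one] using h 1 (by norm_num)
  · have h2 := h 2 le_rfl
    have e (q : Event) : ‖iteratedFDeriv ℝ 2 f q‖ = ‖fderiv ℝ (fderiv ℝ f) q‖ := by
      rw [← norm_iteratedFDeriv_one, norm_iteratedFDeriv_fderiv]
    simpa only [BigODecay, e] using h2

lemma IsSource.isPotential {C : ℝ} {f : Event → F} (hf : IsSource C f) : IsPotential C f := by
  obtain ⟨p, hp, h0, h1, -⟩ := hf.exists_decay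
  exact ⟨hf.1, h0.littleODecay hp zero_le_one, h1.littleODecay hp le_rfl⟩

lemma IsSource.fderiv_lorenzConv {C : ℝ} (hC : 0 < C) {f : Event → F} (hf : IsSource C f) :
    fderiv ℝ (lorenzConv C f) = lorenzConv C (fderiv ℝ f) := by
  obtain ⟨p, hp, h0, h1, -⟩ := hf.exists_decay
  exact funext fun q =>
    (hasFDerivAt_lorenzConv hC hp (hf.1.of_le (by norm_num)) h0 h1 q).fderiv

lemma IsSource.fderiv_lorenzConv_fderiv {C : ℝ} (hC : 0 < C) {f : Event → F}
    (hf : IsSource C f) :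
    fderiv ℝ (lorenzConv C (fderiv ℝ f)) = lorenzConv C (fderiv ℝ (fderiv ℝ f)) := by
  obtain ⟨p, hp, -, h1, h2⟩ := hf.exists_decay
  exact funext fun q =>
    (hasFDerivAt_lorenzConv hC hp (hf.1.fderiv_right (by norm_num)) h1 h2 q).fderiv

lemma IsSource.contDiff_lorenzConv {C : ℝ} (hC : 0 < C) {f : Event → F} (hf : IsSource C f) :
    ContDiff ℝ 2 (lorenzConv C f) := by
  obtain ⟨p, hp, h0, h1, h2⟩ := hf.exists_decay
  have hf1 : ContDiff ℝ 1 (fderiv ℝ f) := hf.1.fderiv_right (by norm_num)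
  rw [show (2 : ℕ∞ω) = 1 + 1 by norm_num, contDiff_succ_iff_fderiv]
  refine ⟨fun q => (hasFDerivAt_lorenzConv hC hp (hf.1.of_le (by norm_num)) h0 h1
    q).differentiableAt, by simp, ?_⟩
  rw [hf.fderiv_lorenzConv hC, contDiff_one_iff_fderiv]
  refine ⟨fun q => (hasFDerivAt_lorenzConv hC hp hf1 h1 h2 q).differentiableAt, ?_⟩
  rw [hf.fderiv_lorenzConv_fderiv hC]
  exact h2.continuous_lorenzConv hC hp (hf1.continuous_fderiv (by norm_num))

-- The norm on spaces of iterated operators is found only by a deeper instance search.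
set_option maxSynthPendingDepth 3 in
lemma IsSource.integrable_fderiv_fderiv {C : ℝ} (hC : 0 < C) {f : Event → F}
    (hf : IsSource C f) (q : Event) :
    Integrable (fun r => fderiv ℝ (fderiv ℝ f) (q - r)) (lorenzKernel C) := by
  obtain ⟨p, hp, -, -, h2⟩ := hf.exists_decay
  exact BigODecay.integrable (G := Event →L[ℝ] Event →L[ℝ] F) hC hp
    (continuous_fderiv_fderiv hf.1) h2 q

-- The norm on spaces of iterated operators is found only by a deeper instance search.
set_option maxSynthPendingDepth 3 in
lemma integrable_boxForm_comp (C : ℝ) {μ : Measure Event}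
    {T : Event → Event →L[ℝ] Event →L[ℝ] F} (hT : Integrable T μ) :
    Integrable (fun r => boxForm C (T r)) μ := by
  have h := ContinuousLinearMap.integrable_comp (boxForm C) hT
  exact h

-- The norm on spaces of iterated operators is found only by a deeper instance search.
set_option maxSynthPendingDepth 3 in
lemma integral_boxForm_comp [CompleteSpace F] (C : ℝ) {μ : Measure Event}
    {T : Event → Event →L[ℝ] Event →L[ℝ] F} (hT : Integrable T μ) :
    ∫ r, boxForm C (T r) ∂μ = boxForm C (∫ r, T r ∂μ) :=
  (boxForm C).integral_comp_comm hT

lemma IsSource.integrable_dAlembert {C : ℝ} (hC : 0 < C) {f : Event → F} (hf : IsSource C f)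
    (q : Event) : Integrable (fun r => dAlembert C f (q - r)) (lorenzKernel C) := by
  simp only [dAlembert_eq_boxForm C hf.1]
  exact integrable_boxForm_comp C (hf.integrable_fderiv_fderiv hC q)

lemma IsSource.lorenzConv_dAlembert_eq [CompleteSpace F] {C : ℝ} (hC : 0 < C) {f : Event → F}
    (hf : IsSource C f) (q : Event) :
    lorenzConv C (dAlembert C f) q = boxForm C (lorenzConv C (fderiv ℝ (fderiv ℝ f)) q) := by
  have h := integral_boxForm_comp C (hf.integrable_fderiv_fderiv hC q)
  rw [lorenzConv, funext (dAlembert_eq_boxForm C hf.1)]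
  exact h

/-- `□ (K ∗ f) = K ∗ (□ f) = -4π f`: differentiation passes to the source, which itself satisfies
the decay conditions on potentials. -/
theorem IsSource.dAlembert_lorenzConv [CompleteSpace F] {C : ℝ} (hC : 0 < C) {f : Event → F}
    (hf : IsSource C f) (q : Event) :
    dAlembert C (lorenzConv C f) q = -(4 * Real.pi) • f q := by
  rw [← hf.isPotential.lorenzConv_dAlembert hC q (hf.integrable_dAlembert hC q),
    hf.lorenzConv_dAlembert_eq hC, dAlembert_eq_boxForm C (hf.contDiff_lorenzConv hC),
    hf.fderiv_lorenzConv hC, hf.fderiv_lorenzConv_fderiv hC]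

end LorenzWave

theorem mainTheorem7 (C : ℝ) (hC : 0 < C)
    (F : Type*) [NormedAddCommGroup F] [NormedSpace ℝ F] [CompleteSpace F] :
    -- `□ K = -4π δ` as distributions on space-time
    (∀ φ : LorenzWave.Event → ℝ, LorenzWave.IsTestFunction φ →
      MeasureTheory.Integrable (LorenzWave.dAlembert C φ) (LorenzWave.lorenzKernel C) ∧
      ∫ p, LorenzWave.dAlembert C φ p ∂(LorenzWave.lorenzKernel C)
        = -(4 * Real.pi) * φ 0) ∧
    -- `□ (K ∗ f) = -4π f` as distributions, on the whole domain of `K ∗`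
    (∀ f : LorenzWave.Event → F, LorenzWave.InKernelDomain C f →
      (∀ᵐ q : LorenzWave.Event, MeasureTheory.Integrable (fun p => f (q - p))
        (LorenzWave.lorenzKernel C)) ∧
      MeasureTheory.LocallyIntegrable (LorenzWave.lorenzConv C f) MeasureTheory.volume ∧
      ∀ φ : LorenzWave.Event → ℝ, LorenzWave.IsTestFunction φ →
        ∫ q, LorenzWave.dAlembert C φ q • LorenzWave.lorenzConv C f q
          = -(4 * Real.pi) • ∫ q, φ q • f q) ∧
    -- `□ (K ∗ f) = -4π f` classically, and `(K ∗ □) A = -4π A` for `A = K ∗ f`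
    (∀ f : LorenzWave.Event → F, LorenzWave.IsSource C f →
      (∀ q, MeasureTheory.Integrable (fun p => f (q - p)) (LorenzWave.lorenzKernel C)) ∧
      ContDiff ℝ 2 (LorenzWave.lorenzConv C f) ∧
      (∀ q, LorenzWave.dAlembert C (LorenzWave.lorenzConv C f) q
        = -(4 * Real.pi) • f q) ∧
      (∀ q, LorenzWave.lorenzConv C (LorenzWave.dAlembert C (LorenzWave.lorenzConv C f)) q
        = -(4 * Real.pi) • LorenzWave.lorenzConv C f q)) ∧
    -- `(K ∗ □) A = -4π A` for potentials vanishing at infinity, wherever `K ∗ □ A` is defined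
    (∀ A : LorenzWave.Event → F, LorenzWave.IsPotential C A →
      ∀ q, MeasureTheory.Integrable (fun p => LorenzWave.dAlembert C A (q - p))
          (LorenzWave.lorenzKernel C) →
        LorenzWave.lorenzConv C (LorenzWave.dAlembert C A) q
          = -(4 * Real.pi) • A q) := by
  refine ⟨fun φ hφ => hφ.integral_dAlembert hC,
    fun f hf => ⟨hf.ae_integrable, hf.locallyIntegrable_lorenzConv,
      fun φ hφ => hf.integral_dAlembert_smul_lorenzConv hC hφ⟩,
    fun f hf => ⟨?_, hf.contDiff_lorenzConv hC, hf.dAlembert_lorenzConv hC, fun q => ?_⟩,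
    fun A hA q hint => hA.lorenzConv_dAlembert hC q hint⟩
  · obtain ⟨p, hp, h0, -⟩ := hf.exists_decay
    exact h0.integrable hC hp hf.1.continuous
  · rw [funext (hf.dAlembert_lorenzConv hC)]
    exact MeasureTheory.integral_smul _ _
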